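/- Setting. Let $S$ and $A$ be Borel spaces (Borel subsets of complete separable metric spaces), let $K\subset S\times A$ be closed with $A(s)=\{a\in A:(s,a)\in K\}\neq\emptyset$ for every $s\in S$, let $Q(\cdot\mid s,a)$ be a stochastic kernel on $S$ given $(s,a)\in K$, and let $r,z:K\to\mathbb{R}$ be measurable. Let $Y$ be a real random variable with values almost surely in a compact interval $[a,b]$. Write $(x)_-=\min\{x,0\}$, $\langle\mu,f\rangle=\int f\,d\mu$, $w(s,a)=1-r(s,a)$ and $\hat w(s)=1-\sup_{a\in A(s)}r(s,a)$. Assume: 1. $r\le 0$, and $\{(s,a)\in K: r(s,a)\ge-\epsilon\}$ is compact for every $\epsilon\ge0$; 2. $z$ is bounded and upper semicontinuous on $K$; 3. $Q$ is weakly continuous: $(s,a)\mapsto\int_S f(\xi)\,Q(d\xi\mid s,a)$ is continuous on $K$ for every bounded continuous $f:S\to\mathbb{R}$; 4. there is a constant $C$ with $\int_S\hat w(\xi)\,Q(d\xi\mid s,a)\le C\,w(s,a)$ for all $(s,a)\in K$. For a measure $\mu$ on $K$ let $\hat\mu(B)=\mu(\{(s,a)\in K: s\in B\})$ be its marginal on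 $S$. The primal problem is to maximize $\langle\mu,r\rangle$ over the probability measures $\mu$ on $K$ such that $\langle\mu,w\rangle<\infty$, $\hat\mu(B)=\int_K Q(B\mid s,a)\,\mu(d(s,a))$ for every Borel set $B\subset S$, and $\langle\mu,(z-\eta)_-\rangle\ge\mathbb{E}[(Y-\eta)_-]$ for every $\eta\in[a,b]$. The dual problem is to minimize $\beta-\mathbb{E}[u(Y)]$ over the triples $(h,\beta,u)$ such that $\beta\in\mathbb{R}$; $h:S\to\mathbb{R}$ is measurable with $\sup_{s}|h(s)|/\hat w(s)<\infty$; $u:\mathbb{R}\to\mathbb{R}$ is of the form $u(x)=\int_{[a,b]}(x-\eta)_-\,\Lambda(d\eta)$ for a finite nonnegative Borel measure $\Lambda$ on $[a,b]$; and $$r(s,a)+u(z(s,a))\le\beta+h(s)-\int_S h(\xi)\,Q(d\xi\mid s,a)\qquad\text{for all }(s,a)\in K.$$ Theorem. Let $\mu^*$ be an optimal solution of the primal problem and $(h^*,\beta^*,u^*)$ an optimal solution of the dual problem. Then $$\langle\mu^*,u^*(z)\rangle=\mathbb{E}[u^*(Y)],$$ and, for $\hat\mu^*$-almost every $s\in S$,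 $$\beta^*+h^*(s)=\sup_{a\in A(s)}\Big\{r(s,a)+u^*(z(s,a))+\int_S h^*(\xi)\,Q(d\xi\mid s,a)\Big\}.$$ -/

import Mathlib

open MeasureTheory ProbabilityTheory Set

noncomputable section

/-- `(x)_- = min {x, 0}`. -/
def lowerPart (x : ℝ) : ℝ := min x 0

/-- The data of an average-reward Markov decision process on Borel spaces `S` (states) and `A`
(actions): the closed set `K` of feasible state-action pairs, with nonempty action sets
`A(s) = {a | (s, a) ∈ K}`, the transition law `Q`, the reward `r` that is maximized and the reward
`z` whose distribution is constrained. -/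
structure DominanceMDP (S A : Type*)
    [TopologicalSpace S] [MeasurableSpace S] [TopologicalSpace A] [MeasurableSpace A] where
  K : Set (S × A)
  isClosed_K : IsClosed K
  exists_action : ∀ s : S, ∃ a : A, (s, a) ∈ K
  Q : Kernel K S
  isMarkov_Q : IsMarkovKernel Q
  r : K → ℝ
  measurable_r : Measurable r
  z : K → ℝ
  measurable_z : Measurable z

namespace DominanceMDP

variable {S A : Type*}
  [TopologicalSpace S] [MeasurableSpace S] [TopologicalSpace A] [MeasurableSpace A]

/-- The set `A(s)` of feasible actions in state `s`. -/
def actions (M : DominanceMDP S A) (s : S) : Set A := {a | (s, a) ∈ M.K}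

/-- The state `s` of a feasible pair `(s, a)`. -/
def state (M : DominanceMDP S A) (k : M.K) : S := k.1.1

/-- The weight `w(s, a) = 1 - r(s, a)` on `K`. -/
def w (M : DominanceMDP S A) (k : M.K) : ℝ := 1 - M.r k

/-- The weight `ŵ(s) = 1 - sup_{a ∈ A(s)} r(s, a)` on `S`. The supremum is over a nonempty set,
and it is bounded above by zero when `r ≤ 0`. -/
def wHat (M : DominanceMDP S A) (s : S) : ℝ := 1 - ⨆ a : M.actions s, M.r ⟨(s, a.1), a.2⟩

/-- The standing assumptions on the model. -/
structure StandingAssumptions (M : DominanceMDP S A) : Prop where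
  r_nonpos : ∀ k, M.r k ≤ 0
  /-- The set `{(s, a) ∈ K | r(s, a) ≥ -ε}` is compact. -/
  isCompact_superlevel : ∀ ε : ℝ, 0 ≤ ε → IsCompact {k : M.K | -ε ≤ M.r k}
  z_bounded : ∃ C : ℝ, ∀ k, |M.z k| ≤ C
  z_usc : UpperSemicontinuous M.z
  /-- `Q` is weakly continuous. -/
  weak_continuity : ∀ f : BoundedContinuousFunction S ℝ, Continuous fun k => ∫ ξ, f ξ ∂(M.Q k)
  /-- The function `(s, a) ↦ ∫ ŵ(ξ) Q(dξ | s, a)` is finite and has finite `w`-norm. -/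
  wHat_kernel_bound : ∃ C : ℝ, ∀ k,
    ∫⁻ ξ, ENNReal.ofReal (M.wHat ξ) ∂(M.Q k) ≤ ENNReal.ofReal (C * M.w k)

/-- The marginal `μ̂` on `S` of a measure `μ` on `K`. -/
def marginal (M : DominanceMDP S A) (μ : Measure M.K) : Measure S := μ.map M.state

/-- `[L₀ μ](B) = μ̂(B) - ∫_K Q(B | s, a) μ(d(s, a))`. -/
def L0 (M : DominanceMDP S A) (μ : Measure M.K) (B : Set S) : ℝ :=
  (M.marginal μ).real B - ∫ k, (M.Q k).real B ∂μ

/-- `[L₁ μ](η) = ∫_K (z(s, a) - η)_- μ(d(s, a))`. -/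
def L1 (M : DominanceMDP S A) (μ : Measure M.K) (η : ℝ) : ℝ :=
  ∫ k, lowerPart (M.z k - η) ∂μ

/-- Feasibility for the primal linear program. The nonnegative elements of `M_w(K)` of total mass
one are exactly the probability measures `μ` on `K` with `∫ w dμ < ∞`. The benchmark is the random
variable `Y` on the probability space `(Ω, P)`. -/
structure PrimalFeasible (M : DominanceMDP S A) {Ω : Type*} [MeasurableSpace Ω] (P : Measure Ω)
    (Y : Ω → ℝ) (a b : ℝ) (μ : Measure M.K) : Prop where
  isProbabilityMeasure : IsProbabilityMeasure μ
  integrable_w : Integrable M.w μ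
  invariant : ∀ B : Set S, MeasurableSet B → M.L0 μ B = 0
  dominance : ∀ η ∈ Icc a b, ∫ ω, lowerPart (Y ω - η) ∂P ≤ M.L1 μ η

/-- `μ` is an optimal solution of the primal linear program: maximize `⟨μ, r⟩` over the feasible
measures. -/
def PrimalOptimal (M : DominanceMDP S A) {Ω : Type*} [MeasurableSpace Ω] (P : Measure Ω)
    (Y : Ω → ℝ) (a b : ℝ) (μ : Measure M.K) : Prop :=
  M.PrimalFeasible P Y a b μ ∧
    ∀ μ' : Measure M.K, M.PrimalFeasible P Y a b μ' → ∫ k, M.r k ∂μ' ≤ ∫ k, M.r k ∂μ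

/-- The set `U([a, b])` of the functions `u(x) = ∫_{[a, b]} (x - η)_- Λ(dη)`, where `Λ ≥ 0` is a
finite Borel measure on `[a, b]`. -/
def utilities (a b : ℝ) : Set (ℝ → ℝ) :=
  {u | ∃ Λ : Measure (Icc a b), IsFiniteMeasure Λ ∧
    ∀ x : ℝ, u x = ∫ η : Icc a b, lowerPart (x - (η : ℝ)) ∂Λ}

/-- The space `F_ŵ(S)` of measurable functions on `S` of finite `ŵ`-norm. -/
def weightedFunctions (M : DominanceMDP S A) : Set (S → ℝ) :=
  {h | Measurable h ∧ ∃ C : ℝ, ∀ s, |h s| ≤ C * M.wHat s}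

/-- Feasibility for the dual linear program. -/
structure DualFeasible (M : DominanceMDP S A) (a b : ℝ) (h : S → ℝ) (β : ℝ) (u : ℝ → ℝ) :
    Prop where
  h_mem : h ∈ M.weightedFunctions
  u_mem : u ∈ utilities a b
  le : ∀ k : M.K, M.r k + u (M.z k) ≤ β + h (M.state k) - ∫ ξ, h ξ ∂(M.Q k)

/-- `(h, β, u)` is an optimal solution of the dual linear program: minimize `β - E[u(Y)]` over the
feasible triples. -/
def DualOptimal (M : DominanceMDP S A) {Ω : Type*} [MeasurableSpace Ω] (P : Measure Ω)
    (Y : Ω → ℝ) (a b : ℝ) (h : S → ℝ) (β : ℝ) (u : ℝ → ℝ) : Prop :=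
  M.DualFeasible a b h β u ∧
    ∀ (h' : S → ℝ) (β' : ℝ) (u' : ℝ → ℝ), M.DualFeasible a b h' β' u' →
      β - ∫ ω, u (Y ω) ∂P ≤ β' - ∫ ω, u' (Y ω) ∂P

end DominanceMDP

end

/-! The heart of the matter is the absence of a duality gap; the rest is complementary slackness.

Pairing the constraints with bounded continuous `h` and utilities `u` gives the convex family `r +
u(z) - E[u(Y)] + Qh - h`. Its members are upper semicontinuous and differ from `r` by a bounded
amount, and `r` has compact superlevel sets. A minimax theorem,
`exists_isProbabilityMeasure_or_exists_le`, therefore applies: for each level `c`, either some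
probability measure gives every member an integral at least `c`, or some member is at most `c`
everywhere. In the first case the measure is primal feasible, because multipliers can be scaled
freely, and has value at least `c`, because `r` is a member. In the second, the member is a dual
feasible point of value `c`. For `c` just above the primal optimum only the second case remains;
this is `dual_le_primal`.

The slack `D` of the dual inequality is nonnegative. Invariance and the absence of a gap give `∫ D ≤
E[u(Y)] - ∫ u(z)`, which is at most zero by dominance. Hence both sides vanish and `D = 0` almost
everywhere. By `ae_marginal_exists`, almost every state then has an action with equality, while dual
feasibility bounds all other actions. -/

section StrongDualityProof

open Filter Topology

/-! ### Finite-dimensional separation -/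

/-- A finite-dimensional theorem of the alternative. -/
theorem exists_stdSimplex_forall_sum_le {ι : Type*} [Fintype ι] {D : Set (ι → ℝ)}
    (hD : Convex ℝ D) (hne : D.Nonempty) (c : ℝ) (h : ∀ y ∈ D, ∃ i, y i < c) :
    ∃ q ∈ stdSimplex ℝ ι, ∀ y ∈ D, ∑ i, q i * y i ≤ c := by
  classical
  have hO : Convex ℝ {x : ι → ℝ | ∀ i, c < x i} := by
    have : {x : ι → ℝ | ∀ i, c < x i} = Set.pi univ fun _ => Ioi c := by ext; simp
    rw [this]
    exact convex_pi fun _ _ => convex_Ioi c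
  have hO' : IsOpen {x : ι → ℝ | ∀ i, c < x i} := by
    simp only [ofPred_forall]
    exact isOpen_iInter_of_finite fun i => isOpen_lt continuous_const (continuous_apply i)
  have hdisj : Disjoint {x : ι → ℝ | ∀ i, c < x i} D := by
    rw [Set.disjoint_left]
    intro x hx hxD
    obtain ⟨i, hi⟩ := h x hxD
    exact absurd (hx i) (not_lt.2 hi.le)
  -- The open orthant above `c` misses `D`; the separating functional, negated and normalised, gives
  -- the weights.
  obtain ⟨f, t, hft, htf⟩ := geometric_hahn_banach_open hO hO' hD hdisj
  set p : ι → ℝ := fun i => - f (Pi.single i 1) with hp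
  have hf : ∀ x, f x = - ∑ i, p i * x i := by
    intro x
    conv_lhs => rw [pi_eq_sum_univ' x]
    simp [hp, mul_comm, map_sum]
  have hp0 : ∀ i, 0 ≤ p i := by
    intro i
    by_contra! hi
    -- Raising coordinate `i` stays in the orthant, so a negative `p i` would make `f` unbounded
    -- above there.
    have key : ∀ s : ℝ, 0 ≤ s → f (fun _ => c + 1) + s * (-p i) < t := by
      intro s hs
      have := hft ((fun _ => c + 1) + s • Pi.single i 1) (by
        intro j
        by_cases hj : j = i
        · subst hj; simp; linarith
        · simp [hj])
      simpa [hp] using this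
    have h0 := key 0 le_rfl
    have := key ((t - f (fun _ => c + 1)) / (-p i)) (div_nonneg (by linarith) (by linarith))
    rw [div_mul_cancel₀ _ (by linarith)] at this
    linarith
  have hsum : 0 < ∑ i, p i := by
    refine lt_of_le_of_ne (Finset.sum_nonneg fun i _ => hp0 i) fun h0 => ?_
    have hz : ∀ i, p i = 0 := fun i =>
      (Finset.sum_eq_zero_iff_of_nonneg fun i _ => hp0 i).1 h0.symm i (Finset.mem_univ i)
    obtain ⟨y, hy⟩ := hne
    have h1 := hft (fun _ => c + 1) (by intro i; simp)
    have h2 := htf y hy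
    simp [hf, hz] at h1 h2
    linarith
  refine ⟨fun i => p i / ∑ j, p j, ⟨fun i => div_nonneg (hp0 i) hsum.le, ?_⟩, fun y hy => ?_⟩
  · rw [← Finset.sum_div, div_self hsum.ne']
  · have h2 := htf y hy
    rw [hf] at h2
    -- The bound passes to the corner `(c, …, c)` as a limit of points of the orthant.
    have h3 : - (c * ∑ i, p i) ≤ t := by
      refine le_of_forall_pos_le_add fun δ hδ => ?_
      have := hft (fun _ => c + δ / ∑ i, p i) (by
        intro i
        have : 0 < δ / ∑ i, p i := by positivity
        simpa using this)
      rw [hf, ← Finset.sum_mul, mul_add, mul_div_cancel₀ _ hsum.ne'] at this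
      linarith
    have : ∑ i, p i / (∑ j, p j) * y i = (∑ i, p i * y i) / ∑ j, p j := by
      rw [Finset.sum_div]
      exact Finset.sum_congr rfl fun i _ => by ring
    rw [this, div_le_iff₀ hsum]
    linarith

/-! ### Semicontinuity and tightness of integral bounds -/

section Compactness

variable {X : Type*} [TopologicalSpace X] [TopologicalSpace.MetrizableSpace X]
  [SecondCountableTopology X] [MeasurableSpace X] [BorelSpace X]

/-- By the layer-cake formula the integral is built from measures of the open sets `{g > s}`; the
portmanteau theorem and Fatou make it lower semicontinuous under weak convergence. -/
theorem isClosed_setOf_lintegral_le_of_lowerSemicontinuous {g : X → ℝ}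
    (hg : LowerSemicontinuous g) (hg0 : ∀ x, 0 ≤ g x) (t : ENNReal) :
    IsClosed {μ : ProbabilityMeasure X | ∫⁻ x, ENNReal.ofReal (g x) ∂(μ : Measure X) ≤ t} := by
  refine IsSeqClosed.isClosed fun μs μ hμs hlim => ?_
  have hmeas : Measurable g := hg.measurable
  have hfatou : ∫⁻ x, ENNReal.ofReal (g x) ∂(μ : Measure X) ≤
      atTop.liminf fun i => ∫⁻ x, ENNReal.ofReal (g x) ∂(μs i : Measure X) := by
    simp_rw [lintegral_eq_lintegral_meas_lt _ (Eventually.of_forall hg0) hmeas.aemeasurable]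
    refine (lintegral_mono fun s => ProbabilityMeasure.le_liminf_measure_open_of_tendsto hlim
      (hg.isOpen_preimage s)).trans ?_
    exact lintegral_liminf_le fun n => Antitone.measurable fun s s' hs =>
      measure_mono fun x hx => lt_of_le_of_lt hs hx
  refine hfatou.trans ?_
  refine (liminf_le_liminf (Eventually.of_forall hμs)).trans ?_
  simp

/-- Markov's inequality on the compact sublevel sets of `g` gives tightness; Prokhorov's theorem
does the rest. -/
theorem isCompact_setOf_lintegral_le_of_isCompact {g : X → ℝ}
    (hg : LowerSemicontinuous g) (hg0 : ∀ x, 0 ≤ g x)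
    (hc : ∀ s : ℝ, IsCompact {x | g x ≤ s}) (t : ENNReal) (ht : t ≠ ⊤) :
    IsCompact {μ : ProbabilityMeasure X | ∫⁻ x, ENNReal.ofReal (g x) ∂(μ : Measure X) ≤ t} := by
  rw [← (isClosed_setOf_lintegral_le_of_lowerSemicontinuous hg hg0 t).closure_eq]
  refine isCompact_closure_of_isTightMeasureSet ?_
  rw [isTightMeasureSet_iff_exists_isCompact_measure_compl_le]
  intro ε hε
  by_cases hε' : ε = ⊤
  · exact ⟨∅, isCompact_empty, by simp [hε']⟩
  have hr : t / ε ≠ ⊤ := ENNReal.div_ne_top ht hε.ne'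
  -- The summand `1` keeps the Markov threshold nonzero even when `t = 0`.
  have hr' : t / ε + 1 ≠ ⊤ := by finiteness
  refine ⟨_, hc (t / ε + 1).toReal, ?_⟩
  rintro _ ⟨μ, hμ, rfl⟩
  have hsub : {x | g x ≤ (t / ε + 1).toReal}ᶜ ⊆ {x | t / ε + 1 ≤ ENNReal.ofReal (g x)} := by
    intro x hx
    simp only [mem_compl_iff, mem_ofPred_eq, not_le] at hx ⊢
    exact (ENNReal.le_ofReal_iff_toReal_le hr' (hg0 x)).2 hx.le
  refine (measure_mono hsub).trans ?_
  have hM := mul_meas_ge_le_lintegral (μ := (μ : Measure X))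
    (ENNReal.measurable_ofReal.comp hg.measurable) (t / ε + 1)
  refine (ENNReal.le_div_iff_mul_le (Or.inl (by simp)) (Or.inl hr')).2
    ((mul_comm _ _).trans_le (hM.trans hμ)) |>.trans ?_
  refine ENNReal.div_le_of_le_mul ?_
  calc t = ε * (t / ε) := (ENNReal.mul_div_cancel hε.ne' hε').symm
    _ ≤ ε * (t / ε + 1) := by gcongr; simp

end Compactness

/-! ### Minimax for integrals -/

section Minimax

variable {X : Type*} [MeasurableSpace X]

theorem integrable_of_abs_sub_le {μ : Measure X} [IsFiniteMeasure μ] {f r : X → ℝ} {B : ℝ}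
    (hf : Measurable f) (hr : Integrable r μ) (hB : ∀ x, |f x - r x| ≤ B) : Integrable f μ := by
  refine ((integrable_const B).add hr.norm).mono' hf.aestronglyMeasurable
    (Eventually.of_forall fun x => ?_)
  have := abs_le.1 (hB x)
  simp only [Pi.add_apply, Real.norm_eq_abs]
  refine abs_le.2 ⟨?_, ?_⟩ <;> linarith [neg_abs_le (r x), le_abs_self (r x)]

theorem convex_setOf_integrals {ι : Type*} {r : X → ℝ} {f : ι → X → ℝ}
    (hf : ∀ μ : Measure X, IsProbabilityMeasure μ → Integrable r μ → ∀ i, Integrable (f i) μ) :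
    Convex ℝ {y : ι → ℝ | ∃ μ : Measure X, IsProbabilityMeasure μ ∧ Integrable r μ ∧
      ∀ i, y i = ∫ x, f i x ∂μ} := by
  rintro y ⟨μ, hμ, hrμ, hy⟩ z ⟨ν, hν, hrν, hz⟩ s t hs ht hst
  refine ⟨ENNReal.ofReal s • μ + ENNReal.ofReal t • ν, ⟨?_⟩, ?_, fun i => ?_⟩
  · simp [← ENNReal.ofReal_add hs ht, hst]
  · exact (hrμ.smul_measure ENNReal.ofReal_ne_top).add_measure
      (hrν.smul_measure ENNReal.ofReal_ne_top)
  · rw [integral_add_measure ((hf μ hμ hrμ i).smul_measure ENNReal.ofReal_ne_top)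
      ((hf ν hν hrν i).smul_measure ENNReal.ofReal_ne_top), integral_smul_measure,
      integral_smul_measure, ENNReal.toReal_ofReal hs, ENNReal.toReal_ofReal ht]
    simp [hy, hz]

/-- Since `B - f` is nonnegative, a single bound on its `lintegral` encodes both integrability and
the lower bound on `∫ f`. -/
theorem lintegral_ofReal_sub_le_iff {μ : Measure X} [IsProbabilityMeasure μ] {f r : X → ℝ}
    {B c : ℝ} (hr : ∀ x, r x ≤ 0) (hrm : Measurable r) (hf : Measurable f)
    (hB : ∀ x, |f x - r x| ≤ B) (hc : c ≤ B) :
    ∫⁻ x, ENNReal.ofReal (B - f x) ∂μ ≤ ENNReal.ofReal (B - c) ↔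
      Integrable r μ ∧ c ≤ ∫ x, f x ∂μ := by
  have h0 : ∀ x, 0 ≤ B - f x := fun x => by linarith [(abs_le.1 (hB x)).2, hr x]
  have key : Integrable f μ → (∫⁻ x, ENNReal.ofReal (B - f x) ∂μ ≤ ENNReal.ofReal (B - c) ↔
      c ≤ ∫ x, f x ∂μ) := by
    intro hint
    rw [← ofReal_integral_eq_lintegral_ofReal (f := fun x => B - f x) ((integrable_const B).sub hint)
      (Eventually.of_forall h0), ENNReal.ofReal_le_ofReal_iff (by linarith),
      integral_sub (integrable_const B) hint]
    simp only [integral_const, probReal_univ, one_smul]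
    constructor <;> intro h <;> linarith
  constructor
  · intro h
    have hint' : Integrable (fun x => B - f x) μ := by
      refine (lintegral_ofReal_ne_top_iff_integrable
        (measurable_const.sub hf).aestronglyMeasurable (Eventually.of_forall h0)).1 ?_
      exact ne_top_of_le_ne_top ENNReal.ofReal_ne_top h
    have hint : Integrable f μ := 
      ((integrable_const B).sub hint').congr (Eventually.of_forall fun x => by simp)
    exact ⟨integrable_of_abs_sub_le hrm hint fun x => abs_sub_comm (f x) (r x) ▸ hB x,
      (key hint).1 h⟩
  · rintro ⟨hri, h⟩
    exact (key (integrable_of_abs_sub_le hf hri hB)).2 h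

variable [TopologicalSpace X] [TopologicalSpace.MetrizableSpace X]
  [SecondCountableTopology X] [BorelSpace X]

/-- A minimax theorem for integrals over probability measures: if no probability measure gives
every function in the convex family `F` an integral `≥ c`, then some function in `F` is `≤ c`. -/
theorem exists_isProbabilityMeasure_or_exists_le {r : X → ℝ} (hr : ∀ x, r x ≤ 0)
    (hcpt : ∀ ε : ℝ, 0 ≤ ε → IsCompact {x | -ε ≤ r x}) {F : Set (X → ℝ)} (hF : Convex ℝ F)
    (hrF : r ∈ F) (husc : ∀ f ∈ F, UpperSemicontinuous f)
    (hB : ∀ f ∈ F, ∃ B : ℝ, ∀ x, |f x - r x| ≤ B) (c : ℝ) :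
    (∃ μ : Measure X, IsProbabilityMeasure μ ∧ Integrable r μ ∧ ∀ f ∈ F, c ≤ ∫ x, f x ∂μ) ∨
      ∃ f ∈ F, ∀ x, f x ≤ c := by
  classical
  rcases isEmpty_or_nonempty X with hX | ⟨⟨x₀⟩⟩
  · exact Or.inr ⟨r, hrF, fun x => (IsEmpty.false x).elim⟩
  by_contra! hcon
  obtain ⟨hcon₁, hcon₂⟩ := hcon
  have hB' : ∀ f : F, ∃ B : ℝ, (∀ x, |f.1 x - r x| ≤ B) ∧ c ≤ B := fun f => by
    obtain ⟨B, h⟩ := hB f.1 f.2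
    -- Taking the bound at least `c` prevents truncation in `ENNReal.ofReal (B - c)`.
    exact ⟨max B c, fun x => (h x).trans (le_max_left _ _), le_max_right _ _⟩
  choose B hBr hBc using hB'
  have hmeas : ∀ f : F, Measurable f.1 := fun f => (husc f.1 f.2).measurable
  set T : F → Set (ProbabilityMeasure X) := fun f =>
    {μ | ∫⁻ x, ENNReal.ofReal (B f - f.1 x) ∂(μ : Measure X) ≤ ENNReal.ofReal (B f - c)} with hT
  have hlsc : ∀ f : F, LowerSemicontinuous fun x => B f - f.1 x := fun f => by
    intro x y hy
    filter_upwards [husc f.1 f.2 x (B f - y) (by linarith)] with x' hx'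
    linarith
  have hnn : ∀ (f : F) x, 0 ≤ B f - f.1 x := fun f x => by
    linarith [(abs_le.1 (hBr f x)).2, hr x]
  have hTmem : ∀ (f : F) (μ : ProbabilityMeasure X),
      μ ∈ T f ↔ Integrable r (μ : Measure X) ∧ c ≤ ∫ x, f.1 x ∂(μ : Measure X) := fun f μ =>
    lintegral_ofReal_sub_le_iff hr (hmeas ⟨r, hrF⟩) (hmeas f) (hBr f) (hBc f)
  have hTclosed : ∀ f, IsClosed (T f) := fun f =>
    isClosed_setOf_lintegral_le_of_lowerSemicontinuous (hlsc f) (hnn f) _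
  have hTcpt : IsCompact (T ⟨r, hrF⟩) := by
    refine isCompact_setOf_lintegral_le_of_isCompact (hlsc ⟨r, hrF⟩) (hnn ⟨r, hrF⟩)
      (fun s => ?_) _ ENNReal.ofReal_ne_top
    refine (hcpt (max (s - B ⟨r, hrF⟩) 0) (le_max_right _ _)).of_isClosed_subset
      ((hlsc ⟨r, hrF⟩).isClosed_preimage s) fun x hx => ?_
    have hx' : B ⟨r, hrF⟩ - r x ≤ s := hx
    have := le_max_left (s - B ⟨r, hrF⟩) 0
    show -max (s - B ⟨r, hrF⟩) 0 ≤ r x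
    linarith
  have hempty : ¬ (T ⟨r, hrF⟩ ∩ ⋂ f, T f).Nonempty := by
    rintro ⟨μ, hμ, hμ'⟩
    rw [mem_iInter] at hμ'
    obtain ⟨f, hf, hlt⟩ := hcon₁ μ inferInstance ((hTmem _ _).1 hμ).1
    exact absurd ((hTmem ⟨f, hf⟩ _).1 (hμ' ⟨f, hf⟩)).2 (not_le.2 hlt)
  -- Compactness of the set for `r` leaves finitely many incompatible constraints.
  have hfin : ∃ t : Finset F, ¬ (T ⟨r, hrF⟩ ∩ ⋂ f ∈ t, T f).Nonempty := by
    by_contra! hall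
    exact hempty (hTcpt.inter_iInter_nonempty T hTclosed hall)
  obtain ⟨t, ht⟩ := hfin
  set t' : Finset F := insert ⟨r, hrF⟩ t with ht'
  have hconv := convex_setOf_integrals (X := X) (r := r) (f := fun i : t' => i.1.1)
    fun μ hμ hri i => integrable_of_abs_sub_le (hmeas i.1) hri (hBr i.1)
  have hint_dirac : ∀ (f : F) (x : X), ∫ x', f.1 x' ∂(Measure.dirac x) = f.1 x := fun f x =>
    integral_dirac _ _
  have hri_dirac : ∀ x : X, Integrable r (Measure.dirac x) := fun x =>
    integrable_dirac (by simp)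
  obtain ⟨q, ⟨hq0, hq1⟩, hq⟩ := exists_stdSimplex_forall_sum_le hconv
    ⟨fun i => i.1.1 x₀, Measure.dirac x₀, inferInstance, hri_dirac x₀,
      fun i => (hint_dirac i.1 x₀).symm⟩ c (by
    rintro y ⟨μ, hμ, hri, hy⟩
    by_contra! hyc
    refine ht ⟨⟨μ, hμ⟩, ?_, ?_⟩
    · refine (hTmem _ _).2 ⟨hri, ?_⟩
      have := hyc ⟨⟨r, hrF⟩, Finset.mem_insert_self _ _⟩
      rwa [hy] at this
    · refine mem_iInter₂.2 fun f hf => ?_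
      refine (hTmem _ _).2 ⟨hri, ?_⟩
      have := hyc ⟨f, Finset.mem_insert_of_mem hf⟩
      rwa [hy] at this)
  -- The convex combination with weights `q` lies in `F`; testing `hq` on Dirac masses bounds it
  -- pointwise by `c`.
  obtain ⟨x, hx⟩ := hcon₂ (∑ i : t', q i • i.1.1)
    (hF.sum_mem (fun i _ => hq0 i) hq1 fun i _ => i.1.2)
  refine absurd (hq (fun i => i.1.1 x) ⟨Measure.dirac x, inferInstance, hri_dirac x,
    fun i => (hint_dirac i.1 x).symm⟩) (not_le.2 ?_)
  simpa using hx

end Minimax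

theorem lowerPart_monotone : Monotone lowerPart := fun _ _ h => min_le_min_right _ h

theorem continuous_lowerPart : Continuous lowerPart := continuous_id.min continuous_const

theorem abs_lowerPart_le (x : ℝ) : |lowerPart x| ≤ |x| := by
  unfold lowerPart
  rcases le_total x 0 with h | h
  · rw [min_eq_left h]
  · rw [min_eq_right h]; simp

theorem abs_lowerPart_sub_le (x η : ℝ) : |lowerPart (x - η)| ≤ |x| + |η| :=
  (abs_lowerPart_le _).trans (abs_sub _ _)

theorem abs_le_max_abs_of_mem_Icc {a b x : ℝ} (hx : x ∈ Icc a b) : |x| ≤ max |a| |b| :=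
  abs_le_max_abs_abs hx.1 hx.2

/-! ### The cone of utilities -/

section Utilities

variable {a b : ℝ}

theorem integrable_lowerPart_sub_Icc (Λ : Measure (Icc a b)) [IsFiniteMeasure Λ] (x : ℝ) :
    Integrable (fun η : Icc a b => lowerPart (x - (η : ℝ))) Λ := by
  refine (integrable_const (|x| + max |a| |b|)).mono'
    (continuous_lowerPart.comp (continuous_const.sub
      continuous_subtype_val)).measurable.aestronglyMeasurable
    (Eventually.of_forall fun η => ?_)
  exact (abs_lowerPart_sub_le x η).trans (by gcongr; exact abs_le_max_abs_of_mem_Icc η.2)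

theorem zero_mem_utilities : (fun _ => 0 : ℝ → ℝ) ∈ DominanceMDP.utilities a b :=
  ⟨0, inferInstance, by simp⟩

theorem add_mem_utilities {u v : ℝ → ℝ} (hu : u ∈ DominanceMDP.utilities a b)
    (hv : v ∈ DominanceMDP.utilities a b) :
    (fun x => u x + v x) ∈ DominanceMDP.utilities a b := by
  obtain ⟨Λ, hΛ, hu⟩ := hu
  obtain ⟨Λ', hΛ', hv⟩ := hv
  refine ⟨Λ + Λ', inferInstance, fun x => ?_⟩
  rw [integral_add_measure (integrable_lowerPart_sub_Icc Λ x) (integrable_lowerPart_sub_Icc Λ' x),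
    ← hu, ← hv]

theorem smul_mem_utilities {u : ℝ → ℝ} (hu : u ∈ DominanceMDP.utilities a b) {t : ℝ}
    (ht : 0 ≤ t) : (fun x => t * u x) ∈ DominanceMDP.utilities a b := by
  obtain ⟨Λ, hΛ, hu⟩ := hu
  refine ⟨ENNReal.ofReal t • Λ, ⟨by simp [ENNReal.mul_lt_top_iff]⟩, fun x => ?_⟩
  rw [integral_smul_measure, ENNReal.toReal_ofReal ht, ← hu, smul_eq_mul]

theorem lowerPart_sub_mem_utilities {η : ℝ} (hη : η ∈ Icc a b) :
    (fun x => lowerPart (x - η)) ∈ DominanceMDP.utilities a b :=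
  ⟨Measure.dirac ⟨η, hη⟩, inferInstance, fun x => by rw [integral_dirac]⟩

theorem monotone_of_mem_utilities {u : ℝ → ℝ} (hu : u ∈ DominanceMDP.utilities a b) :
    Monotone u := by
  obtain ⟨Λ, hΛ, hu⟩ := hu
  intro x y hxy
  rw [hu, hu]
  exact integral_mono (integrable_lowerPart_sub_Icc Λ x) (integrable_lowerPart_sub_Icc Λ y)
    fun η => lowerPart_monotone (by linarith)

theorem continuous_of_mem_utilities {u : ℝ → ℝ} (hu : u ∈ DominanceMDP.utilities a b) :
    Continuous u := by
  obtain ⟨Λ, hΛ, hu⟩ := hu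
  rw [funext hu, continuous_iff_continuousAt]
  intro x₀
  refine continuousAt_of_dominated (bound := fun _ => |x₀| + 1 + max |a| |b|)
    (Eventually.of_forall fun x => (integrable_lowerPart_sub_Icc Λ x).aestronglyMeasurable) ?_
    (integrable_const _) (Eventually.of_forall fun η =>
      (continuous_lowerPart.comp (continuous_id.sub continuous_const)).continuousAt)
  filter_upwards [Metric.ball_mem_nhds x₀ one_pos] with x hx
  refine Eventually.of_forall fun η => (abs_lowerPart_sub_le x η).trans ?_
  have h1 : |x - x₀| < 1 := hx
  have h2 := abs_sub_abs_le_abs_sub x x₀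
  have h3 := abs_le_max_abs_of_mem_Icc η.2
  linarith

theorem exists_abs_le_of_mem_utilities {u : ℝ → ℝ} (hu : u ∈ DominanceMDP.utilities a b) (C : ℝ) :
    ∃ B : ℝ, ∀ x, |x| ≤ C → |u x| ≤ B :=
  ⟨max |u (-C)| |u C|, fun _ hx => abs_le_max_abs_abs
    (monotone_of_mem_utilities hu (abs_le.1 hx).1) (monotone_of_mem_utilities hu (abs_le.1 hx).2)⟩

variable {Ω : Type*} [MeasurableSpace Ω] {P : Measure Ω} [IsProbabilityMeasure P]
  {X : Ω → ℝ} {C : ℝ}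

theorem integrable_comp_of_mem_utilities {u : ℝ → ℝ} (hu : u ∈ DominanceMDP.utilities a b)
    (hX : Measurable X) (hC : ∀ᵐ ω ∂P, |X ω| ≤ C) : Integrable (fun ω => u (X ω)) P := by
  obtain ⟨B, hB⟩ := exists_abs_le_of_mem_utilities hu C
  refine (integrable_const B).mono'
    ((continuous_of_mem_utilities hu).measurable.comp hX).aestronglyMeasurable ?_
  filter_upwards [hC] with ω hω using hB _ hω

theorem integral_integral_lowerPart_sub (Λ : Measure (Icc a b)) [IsFiniteMeasure Λ]
    (hX : Measurable X) (hC : ∀ᵐ ω ∂P, |X ω| ≤ C) :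
    Integrable (fun η : Icc a b => ∫ ω, lowerPart (X ω - (η : ℝ)) ∂P) Λ ∧
    ∫ ω, ∫ η : Icc a b, lowerPart (X ω - (η : ℝ)) ∂Λ ∂P =
      ∫ η : Icc a b, ∫ ω, lowerPart (X ω - (η : ℝ)) ∂P ∂Λ := by
  have hint : Integrable (Function.uncurry fun ω (η : Icc a b) => lowerPart (X ω - (η : ℝ)))
      (P.prod Λ) := by
    have hmeas : Measurable (Function.uncurry fun ω (η : Icc a b) => lowerPart (X ω - (η : ℝ))) :=
      continuous_lowerPart.measurable.comp
        ((hX.comp measurable_fst).sub (measurable_subtype_coe.comp measurable_snd))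
    refine (integrable_const (C + max |a| |b|)).mono' hmeas.aestronglyMeasurable ?_
    have : ∀ᵐ p ∂(P.prod Λ), |X p.1| ≤ C :=
      Measure.quasiMeasurePreserving_fst.ae hC
    filter_upwards [this] with p hp
    exact (abs_lowerPart_sub_le _ _).trans (add_le_add hp (abs_le_max_abs_of_mem_Icc p.2.2))
  exact ⟨hint.integral_prod_right, integral_integral_swap hint⟩

/-- Integrate the dominance constraints against `Λ` and apply Fubini. -/
theorem integral_utility_le {Ω' : Type*} [MeasurableSpace Ω'] {P' : Measure Ω'}
    [IsProbabilityMeasure P'] {X' : Ω' → ℝ} {C' : ℝ} {u : ℝ → ℝ}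
    (hu : u ∈ DominanceMDP.utilities a b)
    (hX : Measurable X) (hC : ∀ᵐ ω ∂P, |X ω| ≤ C)
    (hX' : Measurable X') (hC' : ∀ᵐ ω ∂P', |X' ω| ≤ C')
    (hdom : ∀ η ∈ Icc a b, ∫ ω, lowerPart (X ω - η) ∂P ≤ ∫ ω, lowerPart (X' ω - η) ∂P') :
    ∫ ω, u (X ω) ∂P ≤ ∫ ω, u (X' ω) ∂P' := by
  obtain ⟨Λ, hΛ, hu⟩ := hu
  simp_rw [hu]
  obtain ⟨h1, h2⟩ := integral_integral_lowerPart_sub Λ hX hC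
  obtain ⟨h3, h4⟩ := integral_integral_lowerPart_sub Λ hX' hC'
  rw [h2, h4]
  exact integral_mono h1 h3 fun η => hdom η η.2

end Utilities

theorem integral_kernel_comp_measure {α β : Type*} [MeasurableSpace α] [MeasurableSpace β]
    {κ : Kernel α β} {μ : Measure α} {f : β → ℝ} (hf : Integrable f (κ ∘ₘ μ)) :
    Integrable (fun x => ∫ y, f y ∂(κ x)) μ ∧
      ∫ y, f y ∂(κ ∘ₘ μ) = ∫ x, ∫ y, f y ∂(κ x) ∂μ := by
  rw [Measure.comp_eq_comp_const_apply] at hf ⊢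
  refine ⟨?_, ?_⟩
  · simpa using! hf.integral_comp
  · rw [Kernel.integral_comp hf]
    simp

namespace DominanceMDP

variable {S A : Type*}
  [TopologicalSpace S] [MeasurableSpace S] [TopologicalSpace A] [MeasurableSpace A]
  {M : DominanceMDP S A}

theorem measurable_state : Measurable M.state := measurable_fst.comp measurable_subtype_coe

theorem continuous_state : Continuous M.state := continuous_fst.comp continuous_subtype_val

theorem L0_eq_zero_iff (μ : Measure M.K) [IsProbabilityMeasure μ] :
    (∀ B : Set S, MeasurableSet B → M.L0 μ B = 0) ↔ M.marginal μ = M.Q ∘ₘ μ := by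
  have := M.isMarkov_Q
  have hreal : ∀ B : Set S, MeasurableSet B → ∫ k, (M.Q k).real B ∂μ = (M.Q ∘ₘ μ).real B := by
    intro B hB
    rw [measureReal_def, Measure.bind_apply hB M.Q.aemeasurable]
    exact integral_toReal (M.Q.measurable_coe hB).aemeasurable
      (Eventually.of_forall fun k => measure_lt_top _ _)
  have : IsProbabilityMeasure (M.marginal μ) :=
    Measure.isProbabilityMeasure_map measurable_state.aemeasurable
  constructor
  · intro h
    ext B hB
    have h1 := h B hB
    rw [L0, hreal B hB, sub_eq_zero] at h1
    exact (measureReal_eq_measureReal_iff).1 h1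
  · intro h B hB
    rw [L0, hreal B hB, h, sub_self]

theorem integrable_w_iff (μ : Measure M.K) [IsFiniteMeasure μ] :
    Integrable M.w μ ↔ Integrable M.r μ := by
  constructor
  · intro h
    exact ((integrable_const (1 : ℝ)).sub h).congr (Eventually.of_forall fun k => by simp [w])
  · intro h
    exact (integrable_const (1 : ℝ)).sub h

end DominanceMDP

/-- An affine function bounded below on a half-line has nonnegative slope. Scaling a multiplier thus
turns a bound on the Lagrangian into a constraint. -/
theorem nonneg_of_forall_le_add_mul {c x y : ℝ} (h : ∀ t : ℝ, 0 ≤ t → c ≤ x + t * y) : 0 ≤ y := by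
  by_contra! hy
  have h0 := h 0 le_rfl
  have h1 := h ((x - c + 1) / -y) (div_nonneg (by linarith) (by linarith))
  have h2 : (x - c + 1) / -y * y = -(x - c + 1) := by
    rw [div_neg, neg_mul, div_mul_cancel₀ _ hy.ne]
  linarith

namespace DominanceMDP

variable {S A : Type*}
  [TopologicalSpace S] [MeasurableSpace S] [TopologicalSpace A] [MeasurableSpace A]
  {M : DominanceMDP S A}

/-- The functions `r + u(z) - E[u(Y)] - h + Qh` on `K` for `h` bounded continuous and `u` a
utility. -/
def lagrangeFunctions (M : DominanceMDP S A) {Ω : Type*} [MeasurableSpace Ω] (P : Measure Ω)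
    (Y : Ω → ℝ) (a b : ℝ) : Set (M.K → ℝ) :=
  {f | ∃ (h : BoundedContinuousFunction S ℝ), ∃ u ∈ utilities a b, f = fun k =>
    M.r k + (u (M.z k) - ∫ ω, u (Y ω) ∂P) + (∫ ξ, h ξ ∂(M.Q k) - h (M.state k))}

theorem r_le_iSup (hM : M.StandingAssumptions) (k : M.K) :
    M.r k ≤ ⨆ α : M.actions (M.state k), M.r ⟨(M.state k, α.1), α.2⟩ :=
  le_ciSup (f := fun α : M.actions (M.state k) => M.r ⟨(M.state k, α.1), α.2⟩)
    ⟨0, by rintro _ ⟨α, rfl⟩; exact hM.r_nonpos _⟩ ⟨k.1.2, k.2⟩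

theorem wHat_state_le_w (hM : M.StandingAssumptions) (k : M.K) : M.wHat (M.state k) ≤ M.w k :=
  sub_le_sub_left (r_le_iSup hM k) 1

theorem one_le_wHat (hM : M.StandingAssumptions) (s : S) : 1 ≤ M.wHat s := by
  have := Real.iSup_nonpos fun α : M.actions s => hM.r_nonpos ⟨(s, α.1), α.2⟩
  unfold wHat
  linarith

theorem upperSemicontinuous_r [T2Space S] [T2Space A] (hM : M.StandingAssumptions) :
    UpperSemicontinuous M.r := by
  refine upperSemicontinuous_iff_isClosed_preimage.2 fun y => ?_
  rcases le_or_gt y 0 with hy | hy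
  · have := (hM.isCompact_superlevel (-y) (by linarith)).isClosed
    rw [neg_neg] at this
    exact this
  · convert! isClosed_empty
    ext k
    simpa using (hM.r_nonpos k).trans_lt hy

theorem sigmaCompactSpace_K (hM : M.StandingAssumptions) : SigmaCompactSpace M.K := by
  refine ⟨⟨fun n : ℕ => {k | -(n : ℝ) ≤ M.r k},
    fun n => hM.isCompact_superlevel n n.cast_nonneg, ?_⟩⟩
  refine eq_univ_of_forall fun k => mem_iUnion.2 ?_
  obtain ⟨n, hn⟩ := exists_nat_ge (-M.r k)
  exact ⟨n, show -(n : ℝ) ≤ M.r k by linarith⟩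

/-! ### Lagrangian and feasibility -/

section Duality

variable {Ω : Type*} [MeasurableSpace Ω] {P : Measure Ω}
  {Y : Ω → ℝ} {a b : ℝ}

theorem r_mem_lagrangeFunctions : M.r ∈ M.lagrangeFunctions P Y a b :=
  ⟨0, fun _ => 0, zero_mem_utilities, by ext; simp⟩

theorem convex_lagrangeFunctions [OpensMeasurableSpace S] [IsProbabilityMeasure P]
    (hY : Measurable Y) (hYab : ∀ᵐ ω ∂P, Y ω ∈ Icc a b) :
    Convex ℝ (M.lagrangeFunctions P Y a b) := by
  have hYab' : ∀ᵐ ω ∂P, |Y ω| ≤ max |a| |b| := hYab.mono fun _ => abs_le_max_abs_of_mem_Icc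
  have := M.isMarkov_Q
  rintro _ ⟨h, u, hu, rfl⟩ _ ⟨h', u', hu', rfl⟩ s t hs ht hst
  refine ⟨s • h + t • h', fun x => s * u x + t * u' x,
    add_mem_utilities (smul_mem_utilities hu hs) (smul_mem_utilities hu' ht), ?_⟩
  ext k
  have hi := integrable_comp_of_mem_utilities hu hY hYab'
  have hi' := integrable_comp_of_mem_utilities hu' hY hYab'
  have e1 : ∫ ω, (s * u (Y ω) + t * u' (Y ω)) ∂P =
      s * ∫ ω, u (Y ω) ∂P + t * ∫ ω, u' (Y ω) ∂P := by
    rw [integral_add (hi.const_mul s) (hi'.const_mul t), integral_const_mul, integral_const_mul]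
  have e2 : ∫ ξ, (s • h + t • h') ξ ∂(M.Q k) = s * ∫ ξ, h ξ ∂(M.Q k) + t * ∫ ξ, h' ξ ∂(M.Q k) := by
    simp only [BoundedContinuousFunction.coe_add, BoundedContinuousFunction.coe_smul, Pi.add_apply,
      smul_eq_mul]
    rw [integral_add ((h.integrable _).const_mul s) ((h'.integrable _).const_mul t),
      integral_const_mul, integral_const_mul]
  rw [e1, e2]
  have hst' : s = 1 - t := by linarith
  simp only [Pi.add_apply, Pi.smul_apply, BoundedContinuousFunction.coe_add,
    BoundedContinuousFunction.coe_smul, smul_eq_mul]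
  subst hst'
  ring

theorem abs_integral_kernel_sub_le (h : BoundedContinuousFunction S ℝ) (k : M.K) :
    |∫ ξ, h ξ ∂(M.Q k) - h (M.state k)| ≤ 2 * ‖h‖ := by
  have := M.isMarkov_Q
  have h1 : ‖∫ ξ, h ξ ∂(M.Q k)‖ ≤ ‖h‖ := by
    simpa using norm_integral_le_of_norm_le_const (μ := M.Q k)
      (Eventually.of_forall fun ξ => h.norm_coe_le_norm ξ)
  have h2 : ‖h (M.state k)‖ ≤ ‖h‖ := h.norm_coe_le_norm _
  rw [Real.norm_eq_abs] at h1 h2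
  have := abs_sub (∫ ξ, h ξ ∂(M.Q k)) (h (M.state k))
  linarith

theorem exists_abs_sub_r_le (hM : M.StandingAssumptions) {f : M.K → ℝ}
    (hf : f ∈ M.lagrangeFunctions P Y a b) : ∃ B : ℝ, ∀ k, |f k - M.r k| ≤ B := by
  obtain ⟨h, u, hu, rfl⟩ := hf
  obtain ⟨C, hC⟩ := hM.z_bounded
  obtain ⟨B, hB⟩ := exists_abs_le_of_mem_utilities hu C
  refine ⟨B + |∫ ω, u (Y ω) ∂P| + 2 * ‖h‖, fun k => ?_⟩
  have h1 := hB _ (hC k)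
  have h2 := abs_integral_kernel_sub_le h k
  have h3 := abs_add_le (u (M.z k) - ∫ ω, u (Y ω) ∂P) (∫ ξ, h ξ ∂(M.Q k) - h (M.state k))
  have h4 := abs_sub (u (M.z k)) (∫ ω, u (Y ω) ∂P)
  calc _ = |(u (M.z k) - ∫ ω, u (Y ω) ∂P) + (∫ ξ, h ξ ∂(M.Q k) - h (M.state k))| := by
        congr 1; ring
    _ ≤ _ := by linarith

theorem upperSemicontinuous_of_mem_lagrangeFunctions [T2Space S] [T2Space A]
    (hM : M.StandingAssumptions) {f : M.K → ℝ}
    (hf : f ∈ M.lagrangeFunctions P Y a b) : UpperSemicontinuous f := by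
  obtain ⟨h, u, hu, rfl⟩ := hf
  have hcont : Continuous fun k => ∫ ξ, h ξ ∂(M.Q k) - h (M.state k) :=
    (hM.weak_continuity h).sub (h.continuous.comp continuous_state)
  have huz : UpperSemicontinuous fun k => u (M.z k) - ∫ ω, u (Y ω) ∂P :=
    Continuous.comp_upperSemicontinuous (g := fun x => u x - ∫ ω, u (Y ω) ∂P)
      ((continuous_of_mem_utilities hu).sub continuous_const) hM.z_usc
      fun x y hxy => sub_le_sub_right (monotone_of_mem_utilities hu hxy) _
  exact ((upperSemicontinuous_r hM).add huz).add hcont.upperSemicontinuous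

theorem integral_lagrangeFunction [OpensMeasurableSpace S] (hM : M.StandingAssumptions) {μ : Measure M.K}
    [IsProbabilityMeasure μ] (hr : Integrable M.r μ) (h : BoundedContinuousFunction S ℝ)
    {u : ℝ → ℝ} (hu : u ∈ utilities a b) :
    ∫ k, (M.r k + (u (M.z k) - ∫ ω, u (Y ω) ∂P) + (∫ ξ, h ξ ∂(M.Q k) - h (M.state k))) ∂μ =
      ∫ k, M.r k ∂μ + (∫ k, u (M.z k) ∂μ - ∫ ω, u (Y ω) ∂P) +
        (∫ ξ, h ξ ∂(M.Q ∘ₘ μ) - ∫ ξ, h ξ ∂(M.marginal μ)) := by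
  have := M.isMarkov_Q
  obtain ⟨C, hC⟩ := hM.z_bounded
  have huz := integrable_comp_of_mem_utilities (P := μ) hu M.measurable_z
    (Eventually.of_forall hC)
  obtain ⟨hQ, hQ'⟩ := integral_kernel_comp_measure (κ := M.Q) (μ := μ) (f := h) (h.integrable _)
  have : IsProbabilityMeasure (M.marginal μ) :=
    Measure.isProbabilityMeasure_map measurable_state.aemeasurable
  have hs : Integrable (fun k => h (M.state k)) μ :=
    (h.integrable (M.marginal μ)).comp_measurable measurable_state
  have hs' : ∫ ξ, h ξ ∂(M.marginal μ) = ∫ k, h (M.state k) ∂μ :=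
    integral_map measurable_state.aemeasurable (h.integrable (M.marginal μ)).aestronglyMeasurable
  have huz' : Integrable (fun k => u (M.z k) - ∫ ω, u (Y ω) ∂P) μ := huz.sub (integrable_const _)
  have hQs : Integrable (fun k => ∫ ξ, h ξ ∂(M.Q k) - h (M.state k)) μ := hQ.sub hs
  have hru : Integrable (fun k => M.r k + (u (M.z k) - ∫ ω, u (Y ω) ∂P)) μ := hr.add huz'
  rw [hQ', hs', integral_add hru hQs, integral_add hr huz', integral_sub huz (integrable_const _),
    integral_sub hQ hs]
  simp

/-- Multiples of `h` and `-h` force invariance; nonnegative multiples of `lowerPart (· - η)` force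
dominance at `η`. -/
theorem primalFeasible_of_forall_le_integral [HasOuterApproxClosed S] [BorelSpace S]
    (hM : M.StandingAssumptions) {μ : Measure M.K}
    [IsProbabilityMeasure μ] (hr : Integrable M.r μ) {c : ℝ}
    (hc : ∀ f ∈ M.lagrangeFunctions P Y a b, c ≤ ∫ k, f k ∂μ) :
    M.PrimalFeasible P Y a b μ := by
  have := M.isMarkov_Q
  have : IsProbabilityMeasure (M.marginal μ) :=
    Measure.isProbabilityMeasure_map measurable_state.aemeasurable
  have key : ∀ (h : BoundedContinuousFunction S ℝ) (u : ℝ → ℝ), u ∈ utilities a b →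
      c ≤ ∫ k, M.r k ∂μ + (∫ k, u (M.z k) ∂μ - ∫ ω, u (Y ω) ∂P) +
        (∫ ξ, h ξ ∂(M.Q ∘ₘ μ) - ∫ ξ, h ξ ∂(M.marginal μ)) := fun h u hu => by
    rw [← integral_lagrangeFunction hM hr h hu]
    exact hc _ ⟨h, u, hu, rfl⟩
  refine ⟨inferInstance, (integrable_w_iff μ).2 hr, (L0_eq_zero_iff μ).2 ?_, fun η hη => ?_⟩
  · have hle : ∀ h : BoundedContinuousFunction S ℝ,
        ∫ ξ, h ξ ∂(M.marginal μ) ≤ ∫ ξ, h ξ ∂(M.Q ∘ₘ μ) := fun h => by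
      refine sub_nonneg.1 (nonneg_of_forall_le_add_mul (c := c) (x := ∫ k, M.r k ∂μ)
        fun t _ => ?_)
      have := key (t • h) _ zero_mem_utilities
      simp only [BoundedContinuousFunction.coe_smul, smul_eq_mul, integral_const_mul,
        integral_zero] at this
      linarith
    refine ext_of_forall_integral_eq_of_IsFiniteMeasure fun h => (hle h).antisymm ?_
    have := hle (-h)
    simp only [BoundedContinuousFunction.coe_neg, Pi.neg_apply, integral_neg] at this
    linarith
  · refine sub_nonneg.1 (nonneg_of_forall_le_add_mul (c := c) (x := ∫ k, M.r k ∂μ)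
      fun t ht => ?_)
    have := key 0 _ (smul_mem_utilities (lowerPart_sub_mem_utilities hη) ht)
    simp only [integral_const_mul, BoundedContinuousFunction.coe_zero, Pi.zero_apply,
      integral_zero] at this
    rw [L1]
    linarith

/-- The choice of `β` gives dual value exactly `c`; bounded `h` has finite `ŵ`-norm because `ŵ ≥ 1`.
-/
theorem dualFeasible_of_lagrangeFunction_le [OpensMeasurableSpace S]
    (hM : M.StandingAssumptions)
    {h : BoundedContinuousFunction S ℝ} {u : ℝ → ℝ} (hu : u ∈ utilities a b) {c : ℝ}
    (hc : ∀ k, M.r k + (u (M.z k) - ∫ ω, u (Y ω) ∂P) + (∫ ξ, h ξ ∂(M.Q k) - h (M.state k)) ≤ c) :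
    M.DualFeasible a b h (c + ∫ ω, u (Y ω) ∂P) u where
  h_mem := ⟨h.continuous.measurable, ‖h‖, fun s => (h.norm_coe_le_norm s).trans
    (le_mul_of_one_le_right (norm_nonneg h) (one_le_wHat hM s))⟩
  u_mem := hu
  le k := by linarith [hc k]

end Duality

/-! ### Projection to states and strong duality -/

section StrongDuality

variable [TopologicalSpace.MetrizableSpace S] [BorelSpace S]
  [TopologicalSpace.MetrizableSpace A] [SecondCountableTopology A] [BorelSpace A]

/-- If a measurable property holds almost everywhere on `K`, then almost every state is the state
of a pair with this property. -/
theorem ae_marginal_exists (hM : M.StandingAssumptions) {μ : Measure M.K} [IsFiniteMeasure μ]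
    {E : Set M.K} (hE : MeasurableSet E) (hμE : ∀ᵐ k ∂μ, k ∈ E) :
    ∀ᵐ s ∂(M.marginal μ), ∃ k ∈ E, M.state k = s := by
  have := sigmaCompactSpace_K hM
  -- The projection of `E` need not be Borel, but projections of compact sets are compact. The sets
  -- `C n` exhaust `E` in measure; for `n = 0` the allowed error is infinite.
  have hex : ∀ n : ℕ, ∃ C ⊆ E, IsCompact C ∧ μ E < μ C + (n : ENNReal)⁻¹ := fun n =>
    hE.exists_isCompact_lt_add (measure_ne_top _ _) (by simp)
  choose C hCE hC hlt using hex
  have hmeas : MeasurableSet (⋃ n, M.state '' C n) :=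
    MeasurableSet.iUnion fun n => ((hC n).image continuous_state).measurableSet
  have hle : μ E ≤ μ (M.state ⁻¹' ⋃ n, M.state '' C n) := by
    refine ge_of_tendsto' (x := atTop) (f := fun n : ℕ =>
      μ (M.state ⁻¹' ⋃ n, M.state '' C n) + (n : ENNReal)⁻¹) ?_ fun n => ?_
    · simpa using tendsto_const_nhds.add ENNReal.tendsto_inv_nat_nhds_zero
    · refine (hlt n).le.trans (add_le_add_left (measure_mono fun k hk => ?_) _)
      exact mem_iUnion.2 ⟨n, mem_image_of_mem _ hk⟩
  have hae : ∀ᵐ k ∂μ, M.state k ∈ ⋃ n, M.state '' C n := by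
    refine (ae_iff_measure_eq (measurable_state hmeas).nullMeasurableSet).2 ?_
    refine (measure_mono (subset_univ _)).antisymm ?_
    rw [← (ae_iff_measure_eq hE.nullMeasurableSet).1 hμE]
    exact hle
  filter_upwards [(ae_map_iff measurable_state.aemeasurable hmeas).2 hae] with s hs
  obtain ⟨n, k, hk, rfl⟩ := mem_iUnion.1 hs
  exact ⟨k, hCE n hk, rfl⟩

variable [SecondCountableTopology S]

/-- There is no duality gap. -/
theorem dual_le_primal (hM : M.StandingAssumptions)
    {Ω : Type*} [MeasurableSpace Ω] {P : Measure Ω} [IsProbabilityMeasure P]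
    {Y : Ω → ℝ} (hY : Measurable Y) {a b : ℝ} (hYab : ∀ᵐ ω ∂P, Y ω ∈ Icc a b)
    {μ : Measure M.K} (hμ : M.PrimalOptimal P Y a b μ)
    {h : S → ℝ} {β : ℝ} {u : ℝ → ℝ} (hdual : M.DualOptimal P Y a b h β u) :
    β - ∫ ω, u (Y ω) ∂P ≤ ∫ k, M.r k ∂μ := by
  refine le_of_forall_pos_le_add fun ε hε => ?_
  rcases exists_isProbabilityMeasure_or_exists_le hM.r_nonpos hM.isCompact_superlevel
      (convex_lagrangeFunctions hY hYab) r_mem_lagrangeFunctions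
      (fun f hf => upperSemicontinuous_of_mem_lagrangeFunctions hM hf)
      (fun f hf => exists_abs_sub_r_le hM hf) (∫ k, M.r k ∂μ + ε) with
    ⟨ν, hν, hr, hc⟩ | ⟨_, ⟨h', u', hu', rfl⟩, hc⟩
  · have h1 := hμ.2 ν (primalFeasible_of_forall_le_integral hM hr hc)
    have h2 := hc _ r_mem_lagrangeFunctions
    linarith
  · have := hdual.2 _ _ _ (dualFeasible_of_lagrangeFunction_le hM hu' hc)
    linarith

end StrongDuality

/-- Integrals of functions of finite `ŵ`-norm under a feasible measure. -/
theorem PrimalFeasible.integral_weightedFunction {Ω : Type*} [MeasurableSpace Ω] {P : Measure Ω}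
    {Y : Ω → ℝ} {a b : ℝ} {μ : Measure M.K} (hμ : M.PrimalFeasible P Y a b μ)
    (hM : M.StandingAssumptions) {h : S → ℝ} (hh : h ∈ M.weightedFunctions) :
    Integrable (fun k => h (M.state k)) μ ∧ Integrable (fun k => ∫ ξ, h ξ ∂(M.Q k)) μ ∧
      ∫ k, h (M.state k) ∂μ = ∫ k, ∫ ξ, h ξ ∂(M.Q k) ∂μ := by
  have := hμ.isProbabilityMeasure
  obtain ⟨hmeas, C, hC⟩ := hh
  have hint : Integrable (fun k => h (M.state k)) μ := by
    refine (hμ.integrable_w.const_mul |C|).mono' (hmeas.comp measurable_state).aestronglyMeasurable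
      (Eventually.of_forall fun k => (hC _).trans ?_)
    have h1 := one_le_wHat hM (M.state k)
    have h2 := wHat_state_le_w hM k
    exact mul_le_mul (le_abs_self C) h2 (by linarith) (abs_nonneg C)
  have hint' : Integrable h (M.marginal μ) :=
    (integrable_map_measure hmeas.aestronglyMeasurable measurable_state.aemeasurable).2 hint
  have hinv := (L0_eq_zero_iff μ).1 hμ.invariant
  have heq : ∫ ξ, h ξ ∂(M.marginal μ) = ∫ k, h (M.state k) ∂μ :=
    integral_map measurable_state.aemeasurable hmeas.aestronglyMeasurable
  -- Invariance replaces the marginal by `M.Q ∘ₘ μ`, so integrability of `h` passes to `Qh`.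
  rw [hinv] at hint' heq
  obtain ⟨h1, h2⟩ := integral_kernel_comp_measure hint'
  exact ⟨hint, h1, heq.symm.trans h2⟩

end DominanceMDP

end StrongDualityProof

/-! ### Complementary slackness -/

theorem mainTheorem4 {S A : Type*}
    [TopologicalSpace S] [TopologicalSpace.MetrizableSpace S] [SecondCountableTopology S]
    [MeasurableSpace S] [BorelSpace S] [StandardBorelSpace S]
    [TopologicalSpace A] [TopologicalSpace.MetrizableSpace A] [SecondCountableTopology A]
    [MeasurableSpace A] [BorelSpace A] [StandardBorelSpace A]
    (M : DominanceMDP S A) (hM : M.StandingAssumptions)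
    {Ω : Type*} [MeasurableSpace Ω] (P : Measure Ω) [IsProbabilityMeasure P]
    (Y : Ω → ℝ) (hY : Measurable Y) (a b : ℝ) (hYab : ∀ᵐ ω ∂P, Y ω ∈ Set.Icc a b)
    (μ : Measure M.K) (hμ : M.PrimalOptimal P Y a b μ)
    (h : S → ℝ) (β : ℝ) (u : ℝ → ℝ) (hdual : M.DualOptimal P Y a b h β u) :
    ∫ k, u (M.z k) ∂μ = ∫ ω, u (Y ω) ∂P ∧
    ∀ᵐ s ∂(M.marginal μ),
      IsLUB (Set.range fun α : M.actions s =>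
          M.r ⟨(s, α.1), α.2⟩ + u (M.z ⟨(s, α.1), α.2⟩)
            + ∫ ξ, h ξ ∂(M.Q ⟨(s, α.1), α.2⟩))
        (β + h s) := by
  have := hμ.1.isProbabilityMeasure
  have hgap := DominanceMDP.dual_le_primal hM hY hYab hμ hdual
  obtain ⟨hh, hu, hle⟩ := hdual.1
  obtain ⟨C, hC⟩ := hM.z_bounded
  have hr : Integrable M.r μ := (DominanceMDP.integrable_w_iff μ).1 hμ.1.integrable_w
  have huz : Integrable (fun k => u (M.z k)) μ :=
    integrable_comp_of_mem_utilities hu M.measurable_z (Filter.Eventually.of_forall hC)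
  have hdom : ∫ ω, u (Y ω) ∂P ≤ ∫ k, u (M.z k) ∂μ :=
    integral_utility_le hu hY (hYab.mono fun _ => abs_le_max_abs_of_mem_Icc) M.measurable_z
      (Filter.Eventually.of_forall hC) hμ.1.dominance
  obtain ⟨hhs, hhQ, hheq⟩ := hμ.1.integral_weightedFunction hM hh
  set D : M.K → ℝ := fun k => β + (h (M.state k) - ∫ ξ, h ξ ∂(M.Q k)) - (M.r k + u (M.z k)) with hD
  have hD0 : ∀ k, 0 ≤ D k := fun k => by have := hle k; simp only [hD]; linarith
  have hi1 : Integrable (fun k => h (M.state k) - ∫ ξ, h ξ ∂(M.Q k)) μ := hhs.sub hhQ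
  have hi2 : Integrable (fun k => β + (h (M.state k) - ∫ ξ, h ξ ∂(M.Q k))) μ :=
    (integrable_const β).add hi1
  have hi3 : Integrable (fun k => M.r k + u (M.z k)) μ := hr.add huz
  -- The terms in `h` cancel by invariance.
  have hDint : ∫ k, D k ∂μ = β - (∫ k, M.r k ∂μ + ∫ k, u (M.z k) ∂μ) := by
    rw [hD, integral_sub hi2 hi3, integral_add (integrable_const β) hi1, integral_sub hhs hhQ,
      integral_add hr huz, hheq]
    simp
  have hDnn : 0 ≤ ∫ k, D k ∂μ := integral_nonneg hD0
  refine ⟨by linarith, ?_⟩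
  have hDae : ∀ᵐ k ∂μ, D k = 0 :=
    (integral_eq_zero_iff_of_nonneg hD0 (hi2.sub hi3)).1 (by linarith)
  have hDmeas : Measurable D :=
    (measurable_const.add ((hh.1.comp DominanceMDP.measurable_state).sub
      hh.1.stronglyMeasurable.integral_kernel.measurable)).sub
      (M.measurable_r.add ((continuous_of_mem_utilities hu).measurable.comp M.measurable_z))
  filter_upwards [DominanceMDP.ae_marginal_exists hM (hDmeas (measurableSet_singleton 0)) hDae]
    with s hs
  obtain ⟨k, hk, rfl⟩ := hs
  have hk0 : D k = 0 := hk
  refine IsGreatest.isLUB ⟨⟨⟨k.1.2, k.2⟩, ?_⟩, ?_⟩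
  · change M.r k + u (M.z k) + ∫ ξ, h ξ ∂(M.Q k) = β + h (M.state k)
    simp only [hD] at hk0
    linarith
  · rintro _ ⟨α, rfl⟩
    have : M.r ⟨(M.state k, α.1), α.2⟩ + u (M.z ⟨(M.state k, α.1), α.2⟩) ≤
      β + h (M.state k) - ∫ ξ, h ξ ∂(M.Q ⟨(M.state k, α.1), α.2⟩) := hle ⟨(M.state k, α.1), α.2⟩
    show _ + _ + _ ≤ _
    linarith
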